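/- Let $d\ge 2$, $R\ge 1$, $C\ge 1$. Consider $R$ receivers and a finite number $S$ of satellites in $\mathbb R^d$; every satellite belongs to one of $C$ constellations, and each constellation contains at least one of the satellites. Agent $u$ (receiver or satellite) has a position $x_u\in\mathbb R^d$ and a clock bias $\beta_u\in\mathbb R$, and satellites of the same constellation have the same bias. The measurements are the values of (i) the pseudoranges $\|x_s-x_r\|+\beta_r-\beta_s$ for a given set of pairs of a satellite $s$ and a receiver $r$, and (ii) the distances $\|x_u-x_v\|$ for a given set of unordered pairs of distinct receivers. The positions of the satellites and the bias of one reference constellation are known; the positions and biases of the receivers and the biases of the other constellations are unknown. The network is said to be *located* by its measurements at a configuration $(x,\beta)$ if the set of all values of the unknowns that produce the same measurements as $(x,\beta)$ is discrete. A configuration is *generic* if the $(R+S)d$ coordinates of the positions are not a root of any nonzero polynomial with integer coefficients. Then the minimum number of pseudorange or distance measurements needed to locate a network of $R$ receivers using satellites from $C$ constellations is $R(d+1)+C-1$. That is: 1. Every network as above (with any $S$) that is located at some generic configuration has at least $R(d+1)+C-1$ measurements. 2. There is a network with $R$ receivers, $C$ constellations and $S\ge d$ satellites which has exactly $R(d+1)+C-1$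 measurements and is located at every generic configuration (generic configurations exist). For $R=1$ this number is the classical count $d+C$. -/

import Mathlib

/-- The agents of a GNSS network: `R` receivers (`Sum.inl`) and `S` satellites (`Sum.inr`). -/
abbrev Agent (R S : ℕ) : Type := Fin R ⊕ Fin S

/-- A configuration gives each agent a position in Euclidean `d`-space (first component) and a
clock bias, premultiplied by the celerity of the signal (second component). -/
abbrev Config (d R S : ℕ) : Type :=
  (Agent R S → EuclideanSpace ℝ (Fin d)) × (Agent R S → ℝ)

namespace Config

/-- The pseudorange from agent `u` to agent `v`. -/
noncomputable def pseudorange {d R S : ℕ} (p : Config d R S) (u v : Agent R S) : ℝ :=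
  ‖p.1 u - p.1 v‖ + p.2 v - p.2 u

/-- The distance between the agents `u` and `v`. -/
noncomputable def distance {d R S : ℕ} (p : Config d R S) (u v : Agent R S) : ℝ :=
  ‖p.1 u - p.1 v‖

/-- A configuration is generic if the spatial coordinates of all agents together are not a root of
any nonzero polynomial with integer coefficients. Clock biases are not restricted. -/
def Generic {d R S : ℕ} (p : Config d R S) : Prop :=
  ∀ P : MvPolynomial (Agent R S × Fin d) ℤ,
    MvPolynomial.aeval (fun i : Agent R S × Fin d => p.1 i.1 i.2) P = 0 → P = 0

end Config

/-- A cooperative GNSS network of `R` receivers and `S` satellites belonging to `C` different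
constellations, with its measurements. -/
structure GNSSNetwork (R S C : ℕ) where
  /-- the constellation of each satellite -/
  constellation : Fin S → Fin C
  /-- each of the `C` constellations contributes at least one satellite -/
  constellation_surjective : Function.Surjective constellation
  /-- the measured pseudoranges: `(s, r)` is a pseudorange from satellite `s` to receiver `r` -/
  pseudoranges : Finset (Fin S × Fin R)
  /-- the graph of the measured distances between receivers -/
  distances : SimpleGraph (Fin R)

namespace GNSSNetwork

variable {d R S C : ℕ}

/-- The number of measurements: pseudoranges plus inter-receiver distances. -/
noncomputable def numMeasurements (N : GNSSNetwork R S C) : ℕ :=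
  N.pseudoranges.card + N.distances.edgeSet.ncard

/-- The satellites of each constellation have synchronized clocks. -/
def Synchronized (N : GNSSNetwork R S C) (p : Config d R S) : Prop :=
  ∀ s t : Fin S, N.constellation s = N.constellation t → p.2 (Sum.inr s) = p.2 (Sum.inr t)

/-- The solution set of the GNSS problem whose true configuration is `p`, the time of the
constellation `ref` being the reference: all configurations which agree with `p` in what is known
(satellite positions, biases of the reference constellation), in which each constellation is
synchronized, and which reproduce all measurements. -/
def solutionSet (N : GNSSNetwork R S C) (ref : Fin C) (p : Config d R S) : Set (Config d R S) :=
  {q | (∀ s : Fin S, q.1 (Sum.inr s) = p.1 (Sum.inr s)) ∧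
    (∀ s : Fin S, N.constellation s = ref → q.2 (Sum.inr s) = p.2 (Sum.inr s)) ∧
    N.Synchronized q ∧
    (∀ s r, (s, r) ∈ N.pseudoranges →
      q.pseudorange (Sum.inr s) (Sum.inl r) = p.pseudorange (Sum.inr s) (Sum.inl r)) ∧
    (∀ u v, N.distances.Adj u v →
      q.distance (Sum.inl u) (Sum.inl v) = p.distance (Sum.inl u) (Sum.inl v))}

/-- The network can be located at `p`: the measurements isolate the solutions, i.e. the solution
set is discrete. -/
def Solvable (N : GNSSNetwork R S C) (ref : Fin C) (p : Config d R S) : Prop :=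
  IsDiscrete (N.solutionSet ref p)

end GNSSNetwork

/-! Lower bound: with fewer measurements than unknowns the Jacobian always has a kernel, but a curve
of solutions requires a kernel vector field that is smooth near `p` and nonzero at `p`. Once each
row is multiplied by its distance, the entries are integer polynomials in coordinates and distances,
hence analytic germs integral over the integer polynomials in the coordinates. Linear algebra over
the ring of such germs gives a nonzero kernel vector, and genericity forbids a nonzero germ of this
ring to vanish at `p` (`analyticGerm.eq_zero_of_isIntegralElem`). The measurements are constant
along the integral curve of this field through `p`, so `p` is not isolated
(`GNSSNetwork.le_numMeasurements_of_solvable`).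

Sharpness: pseudoranges from `d + 1` generic satellites of one constellation leave at most two
candidates for a receiver's position and relative bias (`finite_setOf_norm_sub_eq`). One receiver
that also sees a satellite of every other constellation ties all biases to the reference
(`GNSSNetwork.solvable_starNetwork`). The solution set is then finite, hence discrete. -/

open Filter Topology

/-! ### Analytic germs, integrality and kernel vector fields. -/

section AnalyticGerms

variable {E : Type*} [NormedAddCommGroup E] [NormedSpace ℝ E]

/-- The ring of germs of analytic functions has no zero divisors. -/
theorem AnalyticAt.eventuallyEq_zero_or_of_mul {f g : E → ℝ} {x : E} (hf : AnalyticAt ℝ f x)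
    (hg : AnalyticAt ℝ g x) (h : f * g =ᶠ[𝓝 x] 0) : f =ᶠ[𝓝 x] 0 ∨ g =ᶠ[𝓝 x] 0 := by
  refine or_iff_not_imp_left.2 fun hne => ?_
  obtain ⟨r, hr, hball⟩ := Metric.eventually_nhds_iff_ball.1
    ((hf.eventually_analyticAt.and hg.eventually_analyticAt).and h)
  have hU : Metric.ball x r ∈ 𝓝 x := Metric.ball_mem_nhds x hr
  obtain ⟨y, hy, hfy⟩ : ∃ y ∈ Metric.ball x r, f y ≠ 0 := by
    by_contra! hcon
    exact hne (eventually_of_mem hU hcon)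
  -- Near `y` the factor `f` has no zero, so `g` vanishes there; the identity theorem spreads this
  -- over the ball.
  have hgy : g =ᶠ[𝓝 y] 0 := by
    filter_upwards [(hball y hy).1.1.continuousAt.eventually_ne hfy,
      Metric.isOpen_ball.mem_nhds hy] with z hz hzU
    exact (mul_eq_zero.1 (hball z hzU).2).resolve_left hz
  have hg' : AnalyticOnNhd ℝ g (Metric.ball x r) := fun z hz => (hball z hz).1.2
  exact eventually_of_mem hU (hg'.eqOn_zero_of_preconnected_of_eventuallyEq_zero
    (convex_ball x r).isPreconnected hy hgy)

/-- The germs at `x` of real analytic functions. -/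
def analyticGerm (x : E) : Subring (Germ (𝓝 x) ℝ) where
  carrier := {g | ∃ f : E → ℝ, AnalyticAt ℝ f x ∧ (f : Germ (𝓝 x) ℝ) = g}
  mul_mem' := by
    rintro _ _ ⟨f, hf, rfl⟩ ⟨g, hg, rfl⟩
    exact ⟨f * g, hf.mul hg, rfl⟩
  one_mem' := ⟨1, analyticAt_const, rfl⟩
  add_mem' := by
    rintro _ _ ⟨f, hf, rfl⟩ ⟨g, hg, rfl⟩
    exact ⟨f + g, hf.add hg, rfl⟩
  zero_mem' := ⟨0, analyticAt_const, rfl⟩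
  neg_mem' := by
    rintro _ ⟨f, hf, rfl⟩
    exact ⟨-f, hf.neg, rfl⟩

theorem analyticGerm.mul_eq_zero {x : E} {a b : Germ (𝓝 x) ℝ} (ha : a ∈ analyticGerm x)
    (hb : b ∈ analyticGerm x) (h : a * b = 0) : a = 0 ∨ b = 0 := by
  obtain ⟨f, hf, rfl⟩ := ha
  obtain ⟨g, hg, rfl⟩ := hb
  exact (hf.eventuallyEq_zero_or_of_mul hg (Germ.coe_eq.1 h)).imp Germ.coe_eq.2 Germ.coe_eq.2

/-- If no nonzero element of the subring `φ.range` of analytic germs vanishes at `x`, then no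
nonzero analytic germ which is integral over it vanishes at `x`. -/
theorem analyticGerm.eq_zero_of_isIntegralElem {A : Type*} [CommRing A] {x : E}
    (φ : A →+* Germ (𝓝 x) ℝ) (hφ : ∀ a, φ a ∈ analyticGerm x)
    (hφ0 : ∀ a, (φ a).value = 0 → a = 0) {g : Germ (𝓝 x) ℝ} (hg : g ∈ analyticGerm x)
    (hint : φ.IsIntegralElem g) (hval : g.value = 0) : g = 0 := by
  obtain ⟨P, hP, hPg⟩ := hint
  induction hn : P.natDegree using Nat.strong_induction_on generalizing P with
  | _ n ih =>
  have hA : Nontrivial A := by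
    refine ⟨0, 1, fun h01 => ?_⟩
    have : (Germ.value (1 : Germ (𝓝 x) ℝ)) = Germ.value (0 : Germ (𝓝 x) ℝ) := by
      rw [← map_one φ, ← h01, map_zero]
    exact one_ne_zero (α := ℝ) this
  -- At `x` the equation `P(g) = 0` reduces to its constant term, so that coefficient is zero by
  -- `hφ0`. Then `P = X * Q`, and a nonzero `g` can be cancelled, leaving a monic equation of
  -- smaller degree.
  have h0 : P.coeff 0 = 0 := by
    apply hφ0
    have h := congrArg (Germ.valueRingHom (x := x) (E := ℝ)) hPg
    have hg0 : Germ.valueRingHom g = 0 := hval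
    rw [Polynomial.hom_eval₂, hg0, Polynomial.eval₂_at_zero, map_zero] at h
    exact h
  obtain ⟨Q, rfl⟩ := Polynomial.X_dvd_iff.2 h0
  have hQ : Q.Monic := Polynomial.Monic.of_mul_monic_left Polynomial.monic_X hP
  rw [Polynomial.eval₂_mul, Polynomial.eval₂_X] at hPg
  have hQmem : Polynomial.eval₂ φ g Q ∈ analyticGerm x := by
    rw [Polynomial.eval₂_eq_sum_range]
    exact sum_mem fun i _ => mul_mem (hφ _) (pow_mem hg _)
  refine (analyticGerm.mul_eq_zero hg hQmem hPg).elim id fun h => ih Q.natDegree ?_ Q hQ h rfl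
  rw [← hn, Polynomial.natDegree_X_mul hQ.ne_zero]
  exact Nat.lt_succ_self _

/-- Germs of analytic functions which are integral over the image of `φ`. -/
def integralAnalyticGerm {A : Type*} [CommRing A] {x : E} (φ : A →+* Germ (𝓝 x) ℝ) :
    Subring (Germ (𝓝 x) ℝ) where
  carrier := {g | g ∈ analyticGerm x ∧ φ.IsIntegralElem g}
  mul_mem' ha hb := ⟨mul_mem ha.1 hb.1, ha.2.mul φ hb.2⟩
  one_mem' := ⟨one_mem _, φ.isIntegralElem_one⟩
  add_mem' ha hb := ⟨add_mem ha.1 hb.1, ha.2.add φ hb.2⟩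
  zero_mem' := ⟨zero_mem _, φ.isIntegralElem_zero⟩
  neg_mem' ha := ⟨neg_mem ha.1, ha.2.neg⟩

/-- A matrix of analytic functions with fewer rows than columns, whose entries are integral over
a ring of functions none of which vanishes at `x` unless it is zero, has an analytic kernel vector
field which does not vanish at `x`. -/
theorem exists_analyticAt_mulVec_eq_zero {A M K : Type*} [CommRing A] [Fintype M] [Fintype K]
    {x : E} (φ : A →+* Germ (𝓝 x) ℝ) (hφ : ∀ a, φ a ∈ analyticGerm x)
    (hφ0 : ∀ a, (φ a).value = 0 → a = 0) (hcard : Fintype.card M < Fintype.card K)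
    (W : E → Matrix M K ℝ)
    (hW : ∀ i k, (((fun y => W y i k : E → ℝ)) : Germ (𝓝 x) ℝ) ∈ integralAnalyticGerm φ) :
    ∃ v : K → E → ℝ, (∀ k, AnalyticAt ℝ (v k) x) ∧ (∃ k, v k x ≠ 0) ∧
      ∀ᶠ y in 𝓝 x, ∀ i, ∑ k, W y i k * v k y = 0 := by
  classical
  let B := integralAnalyticGerm φ
  let W' : Matrix M K B := fun i k => ⟨_, hW i k⟩
  -- The strong rank condition holds over any nontrivial commutative ring. Working without fractions
  -- keeps the kernel vector integral.
  have hinj : ¬ Function.Injective W'.mulVecLin := fun h =>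
    absurd (card_le_of_injective B W'.mulVecLin h) (by omega)
  obtain ⟨c, hc, hc0⟩ : ∃ c, W'.mulVecLin c = 0 ∧ c ≠ 0 := by
    by_contra! hcon
    exact hinj ((injective_iff_map_eq_zero _).2 hcon)
  choose v hv hvc using fun k => (c k).2.1
  refine ⟨v, hv, ?_, ?_⟩
  · obtain ⟨k, hk⟩ := Function.ne_iff.1 hc0
    refine ⟨k, fun h => hk (Subtype.ext ?_)⟩
    refine analyticGerm.eq_zero_of_isIntegralElem φ hφ hφ0 (c k).2.1 (c k).2.2 ?_
    rw [← hvc k]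
    exact h
  · refine eventually_all.2 fun i => ?_
    have h := congrArg Subtype.val (congrFun hc i)
    have hsum : (((fun y => ∑ k, W y i k * v k y : E → ℝ)) : Germ (𝓝 x) ℝ) = 0 := by
      have h1 : (fun y => ∑ k, W y i k * v k y : E → ℝ) = ∑ k, (fun y => W y i k) * v k := by
        ext y
        simp
      rw [h1]
      refine Eq.trans ?_ h
      change Germ.coeRingHom (𝓝 x) _ = _
      rw [map_sum]
      simp only [map_mul, Matrix.mulVecLin_apply, Matrix.mulVec, dotProduct]
      push_cast
      refine Finset.sum_congr rfl fun k _ => ?_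
      rw [← hvc k]
      rfl
    exact Germ.coe_eq.1 hsum

end AnalyticGerms

/-! ### Existence of generic configurations. -/

section GenericExistence

open Cardinal in
/-- There are arbitrarily large finite families of algebraically independent real numbers. -/
theorem exists_algebraicIndependent_real (ι : Type) [Finite ι] :
    ∃ x : ι → ℝ, AlgebraicIndependent ℤ x := by
  obtain ⟨κ, b, hb⟩ := exists_isTranscendenceBasis' ℚ ℝ
  have hκ : Infinite κ := by
    -- A finite transcendence basis would make the reals algebraic over a countable ring, hence
    -- countable.
    by_contra hfin
    rw [not_infinite_iff_finite] at hfin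
    have hcount : Countable (MvPolynomial κ ℚ) := by
      rw [← mk_le_aleph0_iff]
      refine MvPolynomial.cardinalMk_le_max_lift.trans ?_
      simp
    have := hb.isAlgebraic
    have h1 := Algebra.IsAlgebraic.cardinalMk_le_max (Algebra.adjoin ℚ (Set.range b)) ℝ
    have h2 : #(Algebra.adjoin ℚ (Set.range b)) ≤ ℵ₀ := by
      rw [mk_le_aleph0_iff]
      exact hb.1.aevalEquiv.symm.toEquiv.injective.countable
    rw [mk_real] at h1
    exact absurd (h1.trans (max_le h2 le_rfl)) (not_le.2 aleph0_lt_continuum)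
  obtain ⟨e⟩ : Nonempty (ι ↪ κ) := by
    obtain ⟨n, ⟨f⟩⟩ := Finite.exists_equiv_fin ι
    exact ⟨f.toEmbedding.trans (Fin.valEmbedding.trans (Infinite.natEmbedding κ))⟩
  exact ⟨b ∘ e, (hb.1.comp e e.injective).restrictScalars (algebraMap ℤ ℚ).injective_int⟩

theorem Config.exists_generic (d R S : ℕ) : ∃ p : Config d R S, p.Generic ∧ ∀ u, p.2 u = 0 := by
  obtain ⟨x, hx⟩ := exists_algebraicIndependent_real (Agent R S × Fin d)
  exact ⟨(fun u => WithLp.toLp 2 fun j => x (u, j), 0),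
    fun P hP => (injective_iff_map_eq_zero _).1 hx P hP, fun _ => rfl⟩

end GenericExistence

/-! ### Coordinates and distances as integral analytic germs. -/

section CoordinateGerms

variable {d R S : ℕ}

/-- Evaluation of integer polynomials in the coordinates of the agents, as germs of functions of
the positions. -/
noncomputable def coordGerm (x : Agent R S → EuclideanSpace ℝ (Fin d)) :
    MvPolynomial (Agent R S × Fin d) ℤ →+* Germ (𝓝 x) ℝ :=
  MvPolynomial.eval₂Hom (Int.castRingHom _)
    fun i => ((fun y => y i.1 i.2 : (Agent R S → EuclideanSpace ℝ (Fin d)) → ℝ) : Germ (𝓝 x) ℝ)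

variable {x : Agent R S → EuclideanSpace ℝ (Fin d)}

theorem analyticAt_coord (u : Agent R S) (j : Fin d) :
    AnalyticAt ℝ (fun y : Agent R S → EuclideanSpace ℝ (Fin d) => y u j) x :=
  ((EuclideanSpace.proj (𝕜 := ℝ) j).comp
    (ContinuousLinearMap.proj (R := ℝ) (φ := fun _ : Agent R S => EuclideanSpace ℝ (Fin d))
      u)).analyticAt x

theorem coordGerm_mem (P : MvPolynomial (Agent R S × Fin d) ℤ) :
    coordGerm x P ∈ analyticGerm x := by
  induction P using MvPolynomial.induction_on with
  | C a => simp [coordGerm]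
  | add p q hp hq => rw [map_add]; exact add_mem hp hq
  | mul_X p i hp =>
    rw [map_mul]
    refine mul_mem hp ?_
    simp only [coordGerm, MvPolynomial.coe_eval₂Hom, MvPolynomial.eval₂_X]
    exact ⟨_, analyticAt_coord i.1 i.2, rfl⟩

/-- Translates genericity into the hypothesis `hφ0` of the germ lemmas. -/
theorem value_coordGerm (P : MvPolynomial (Agent R S × Fin d) ℤ) :
    (coordGerm x P).value = MvPolynomial.aeval (fun i => x i.1 i.2) P := by
  have h : (Germ.valueRingHom (x := x) (E := ℝ)).comp (coordGerm x) =
      ((MvPolynomial.aeval (fun i : Agent R S × Fin d => x i.1 i.2)).toRingHom :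
        MvPolynomial (Agent R S × Fin d) ℤ →+* ℝ) := by
    refine MvPolynomial.ringHom_ext' (RingHom.ext_int _ _) fun i => ?_
    simp only [coordGerm, RingHom.comp_apply, MvPolynomial.coe_eval₂Hom, MvPolynomial.eval₂_X,
      AlgHom.toRingHom_eq_coe, RingHom.coe_coe, MvPolynomial.aeval_X]
    rfl
  exact congrArg (fun f => f P) h

theorem coord_mem_integralAnalyticGerm (u : Agent R S) (j : Fin d) :
    ((fun y => y u j : (Agent R S → EuclideanSpace ℝ (Fin d)) → ℝ) : Germ (𝓝 x) ℝ) ∈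
      integralAnalyticGerm (coordGerm x) := by
  refine ⟨⟨_, analyticAt_coord u j, rfl⟩, ?_⟩
  have h := (coordGerm x).isIntegralElem_map (x := MvPolynomial.X (u, j))
  simpa [coordGerm] using h

theorem coord_sub_mem_integralAnalyticGerm (u v : Agent R S) (j : Fin d) :
    ((fun y => y u j - y v j : (Agent R S → EuclideanSpace ℝ (Fin d)) → ℝ) : Germ (𝓝 x) ℝ) ∈
      integralAnalyticGerm (coordGerm x) :=
  sub_mem (coord_mem_integralAnalyticGerm u j) (coord_mem_integralAnalyticGerm v j)

/-- The square of the distance is a polynomial in the coordinates, so the distance is integral; it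
is analytic where the two points differ. -/
theorem norm_sub_mem_integralAnalyticGerm {u v : Agent R S} (h : x u ≠ x v) :
    ((fun y => ‖y u - y v‖ : (Agent R S → EuclideanSpace ℝ (Fin d)) → ℝ) : Germ (𝓝 x) ℝ) ∈
      integralAnalyticGerm (coordGerm x) := by
  refine ⟨⟨_, ?_, rfl⟩, ?_⟩
  · have hc : ContDiffAt ℝ ⊤ (fun y : Agent R S → EuclideanSpace ℝ (Fin d) => y u - y v) x := by
      fun_prop
    exact ContDiffAt.analyticAt (hc.norm ℝ (sub_ne_zero.2 h))
  · have hs : ((fun y => ‖y u - y v‖ : (Agent R S → EuclideanSpace ℝ (Fin d)) → ℝ) :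
        Germ (𝓝 x) ℝ) ^ 2 ∈ integralAnalyticGerm (coordGerm x) := by
      have h2 : ((fun y => ‖y u - y v‖ : (Agent R S → EuclideanSpace ℝ (Fin d)) → ℝ) :
          Germ (𝓝 x) ℝ) ^ 2 = ∑ j, ((fun y => y u j - y v j :
            (Agent R S → EuclideanSpace ℝ (Fin d)) → ℝ) : Germ (𝓝 x) ℝ) ^ 2 := by
        have h3 : (fun y : Agent R S → EuclideanSpace ℝ (Fin d) => ‖y u - y v‖) ^ 2 =
            ∑ j, (fun y => y u j - y v j) ^ 2 := by
          ext y
          simp [EuclideanSpace.norm_sq_eq]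
        have h4 := congrArg (Germ.coeRingHom (𝓝 x)) h3
        rw [map_pow, map_sum] at h4
        simp only [map_pow] at h4
        exact h4
      rw [h2]
      exact sum_mem fun j _ => pow_mem (coord_sub_mem_integralAnalyticGerm u v j) 2
    let := (coordGerm x).toAlgebra
    exact IsIntegral.of_pow (R := MvPolynomial (Agent R S × Fin d) ℤ) two_pos hs.2

theorem Config.Generic.injective {p : Config d R S} (hp : p.Generic) (hd : 0 < d) :
    Function.Injective p.1 := by
  intro u v huv
  by_contra hne
  have h := hp (MvPolynomial.X (u, ⟨0, hd⟩) - MvPolynomial.X (v, ⟨0, hd⟩)) (by simp [huv])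
  have h' := congrArg (MvPolynomial.aeval
    (fun i : Agent R S × Fin d => if i.1 = u then (1 : ℤ) else 0)) h
  simp [Ne.symm hne] at h'

end CoordinateGerms

/-! ### The lower bound: Jacobian and curve of solutions. -/

theorem HasDerivAt.norm_of_ne_zero {F : Type*} [NormedAddCommGroup F] [InnerProductSpace ℝ F]
    {z : ℝ → F} {z' : F} {t : ℝ} (hz : HasDerivAt z z' t) (h0 : z t ≠ 0) :
    HasDerivAt (fun s => ‖z s‖) (Inner.inner ℝ (z t) z' / ‖z t‖) t := by
  have h := hz.norm_sq.sqrt (by simpa using h0)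
  simp only [Real.sqrt_sq (norm_nonneg _)] at h
  rwa [mul_div_mul_left _ _ two_ne_zero] at h

namespace GNSSNetwork

variable {d R S C : ℕ}

/-- The unknowns: coordinates and biases of the receivers, and the biases of the constellations
other than the reference one. -/
abbrev Unknown (d R : ℕ) {C : ℕ} (ref : Fin C) : Type :=
  (Fin R × Fin d) ⊕ Fin R ⊕ {c : Fin C // c ≠ ref}

theorem card_unknown (ref : Fin C) :
    Fintype.card (Unknown d R ref) = R * (d + 1) + C - 1 := by
  have hC : 1 ≤ C := Fin.pos ref
  simp only [Fintype.card_sum, Fintype.card_prod, Fintype.card_fin, ne_eq,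
    Fintype.card_subtype_compl, Fintype.card_unique]
  rw [mul_add]
  omega

/-- The measurements. -/
abbrev Measurement (N : GNSSNetwork R S C) : Type :=
  {e // e ∈ N.pseudoranges} ⊕ N.distances.edgeSet

noncomputable instance (N : GNSSNetwork R S C) : Fintype N.Measurement := Fintype.ofFinite _

theorem card_measurement (N : GNSSNetwork R S C) :
    Fintype.card N.Measurement = N.numMeasurements := by
  rw [← Nat.card_eq_fintype_card, Nat.card_sum, numMeasurements, Nat.card_coe_set_eq]
  simp

/-- The agents between which a measurement takes place. -/
noncomputable def ends (N : GNSSNetwork R S C) : N.Measurement → Agent R S × Agent R S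
  | Sum.inl e => (Sum.inr e.1.1, Sum.inl e.1.2)
  | Sum.inr e => (Sum.inl (Quot.out e.1).1, Sum.inl (Quot.out e.1).2)

theorem ends_ne (N : GNSSNetwork R S C) (i : N.Measurement) : (N.ends i).1 ≠ (N.ends i).2 := by
  rcases i with e | ⟨e, he⟩
  · simp [ends]
  · intro h
    have h1 : s((Quot.out e).1, (Quot.out e).2) = e := Quot.out_eq e
    rw [← h1, SimpleGraph.mem_edgeSet] at he
    exact he.ne (Sum.inl_injective h)

/-- The coefficient of the clock biases in a measurement. -/
def biasCoeff (N : GNSSNetwork R S C) : N.Measurement → ℤ :=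
  Sum.elim (fun _ => 1) (fun _ => 0)

/-- The value of a measurement. -/
noncomputable def measure (N : GNSSNetwork R S C) (q : Config d R S) (i : N.Measurement) : ℝ :=
  ‖q.1 (N.ends i).1 - q.1 (N.ends i).2‖ +
    N.biasCoeff i * (q.2 (N.ends i).2 - q.2 (N.ends i).1)

theorem mem_solutionSet_of_measure_eq (N : GNSSNetwork R S C) (ref : Fin C) {p q : Config d R S}
    (h1 : ∀ s, q.1 (Sum.inr s) = p.1 (Sum.inr s))
    (h2 : ∀ s, N.constellation s = ref → q.2 (Sum.inr s) = p.2 (Sum.inr s))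
    (h3 : N.Synchronized q) (h : ∀ i, N.measure q i = N.measure p i) :
    q ∈ N.solutionSet ref p := by
  refine ⟨h1, h2, h3, fun s r hsr => ?_, fun u v huv => ?_⟩
  · simpa [measure, biasCoeff, ends, Config.pseudorange, add_sub_assoc] using
      h (Sum.inl ⟨(s, r), hsr⟩)
  have h4 := h (Sum.inr ⟨s(u, v), huv⟩)
  have h5 : s((Quot.out s(u, v)).1, (Quot.out s(u, v)).2) = s(u, v) := Quot.out_eq _
  simp only [measure, biasCoeff, Sum.elim_inr, ends, Int.cast_zero, zero_mul, add_zero] at h4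
  -- `Quot.out` may return the edge in either orientation; the distance is symmetric.
  rcases Sym2.eq_iff.1 h5 with ⟨ha, hb⟩ | ⟨ha, hb⟩
  · simp only [ha, hb] at h4
    exact h4
  · simp only [ha, hb] at h4
    rw [Config.distance, Config.distance, norm_sub_rev, h4, norm_sub_rev]

/-- The derivative of the positions along a change of the unknowns. -/
noncomputable def posVelocity (S : ℕ) (ref : Fin C) :
    (Unknown d R ref → ℝ) →L[ℝ] (Agent R S → EuclideanSpace ℝ (Fin d)) :=
  LinearMap.toContinuousLinearMap
    { toFun := fun w => Sum.elim (fun r => WithLp.toLp 2 fun j => w (Sum.inl (r, j))) (fun _ => 0)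
      map_add' := fun v w => by
        ext (a | a) j <;> simp
      map_smul' := fun c w => by
        ext (a | a) j <;> simp }

/-- The derivative of the biases along a change of the unknowns. -/
noncomputable def biasVelocity (N : GNSSNetwork R S C) (d : ℕ) (ref : Fin C) :
    (Unknown d R ref → ℝ) →L[ℝ] (Agent R S → ℝ) :=
  LinearMap.toContinuousLinearMap
    { toFun := fun w => Sum.elim (fun r => w (Sum.inr (Sum.inl r)))
        (fun s => if h : N.constellation s ≠ ref then w (Sum.inr (Sum.inr ⟨_, h⟩)) else 0)
      map_add' := fun v w => by
        ext (a | a)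
        · simp
        · by_cases h : N.constellation a = ref <;> simp [h]
      map_smul' := fun c w => by
        ext (a | a)
        · simp
        · by_cases h : N.constellation a = ref <;> simp [h] }

@[simp] theorem posVelocity_inl (ref : Fin C) (w : Unknown d R ref → ℝ) (r : Fin R) :
    posVelocity S ref w (Sum.inl r) = WithLp.toLp 2 fun j => w (Sum.inl (r, j)) := rfl

@[simp] theorem posVelocity_inr (ref : Fin C) (w : Unknown d R ref → ℝ) (s : Fin S) :
    posVelocity S ref w (Sum.inr s) = 0 := rfl

@[simp] theorem biasVelocity_inl (N : GNSSNetwork R S C) (ref : Fin C)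
    (w : Unknown d R ref → ℝ) (r : Fin R) :
    N.biasVelocity d ref w (Sum.inl r) = w (Sum.inr (Sum.inl r)) := rfl

theorem biasVelocity_inr (N : GNSSNetwork R S C) (ref : Fin C)
    (w : Unknown d R ref → ℝ) (s : Fin S) :
    N.biasVelocity d ref w (Sum.inr s) =
      if h : N.constellation s ≠ ref then w (Sum.inr (Sum.inr ⟨_, h⟩)) else 0 := rfl

/-- Together with its analogue for biases, this gives the scaled Jacobian integer coefficients. -/
theorem posVelocity_single (ref : Fin C) (k : Unknown d R ref) (a : Agent R S) (j : Fin d) :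
    ∃ n : ℤ, posVelocity S ref (Pi.single k 1) a j = n := by
  rcases a with r | s
  · exact ⟨if Sum.inl (r, j) = k then 1 else 0, by simp [Pi.single_apply]⟩
  · exact ⟨0, by simp⟩

theorem biasVelocity_single (N : GNSSNetwork R S C) (ref : Fin C) (k : Unknown d R ref)
    (a : Agent R S) : ∃ n : ℤ, N.biasVelocity d ref (Pi.single k 1) a = n := by
  rcases a with r | s
  · exact ⟨if Sum.inr (Sum.inl r) = k then 1 else 0, by simp [Pi.single_apply]⟩
  · rw [biasVelocity_inr]
    by_cases h : N.constellation s ≠ ref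
    · exact ⟨if Sum.inr (Sum.inr ⟨_, h⟩) = k then 1 else 0, by simp [Pi.single_apply, h]⟩
    · exact ⟨0, by simp [h]⟩

/-- The configuration obtained by changing the unknowns by `u`. -/
noncomputable def shift (N : GNSSNetwork R S C) (ref : Fin C) (p : Config d R S)
    (u : Unknown d R ref → ℝ) : Config d R S :=
  (p.1 + posVelocity S ref u, p.2 + N.biasVelocity d ref u)

@[simp] theorem shift_zero (N : GNSSNetwork R S C) (ref : Fin C) (p : Config d R S) :
    N.shift ref p 0 = p := by
  simp [shift]

/-- The bias of a constellation is read off one of its satellites, so nonempty constellations matter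
here. -/
theorem shift_injective (N : GNSSNetwork R S C) (ref : Fin C) (p : Config d R S) :
    Function.Injective (N.shift ref p) := by
  intro u v huv
  have h1 : posVelocity S ref u = posVelocity S ref v :=
    add_left_cancel (congrArg Prod.fst huv)
  have h2 : N.biasVelocity d ref u = N.biasVelocity d ref v :=
    add_left_cancel (congrArg Prod.snd huv)
  ext k
  rcases k with ⟨r, j⟩ | r | ⟨c, hc⟩
  · simpa using congrArg (fun z : EuclideanSpace ℝ (Fin d) => z j) (congrFun h1 (Sum.inl r))
  · simpa using congrFun h2 (Sum.inl r)
  · obtain ⟨s, rfl⟩ := N.constellation_surjective c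
    simpa [biasVelocity_inr, hc] using congrFun h2 (Sum.inr s)

theorem Synchronized.shift {N : GNSSNetwork R S C} {p : Config d R S} (hp : N.Synchronized p)
    (ref : Fin C) (u : Unknown d R ref → ℝ) : N.Synchronized (N.shift ref p u) := by
  intro s t hst
  simp only [GNSSNetwork.shift, Pi.add_apply, hp s t hst, biasVelocity_inr, hst]

/-- The derivatives of the measurements with respect to the unknowns, multiplied by the distance
of the two agents. -/
noncomputable def jacobian (N : GNSSNetwork R S C) (ref : Fin C)
    (y : Agent R S → EuclideanSpace ℝ (Fin d)) (i : N.Measurement) :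
    (Unknown d R ref → ℝ) →ₗ[ℝ] ℝ where
  toFun w := inner ℝ (y (N.ends i).1 - y (N.ends i).2)
      (posVelocity S ref w (N.ends i).1 - posVelocity S ref w (N.ends i).2) +
    ‖y (N.ends i).1 - y (N.ends i).2‖ * (N.biasCoeff i *
      (N.biasVelocity d ref w (N.ends i).2 - N.biasVelocity d ref w (N.ends i).1))
  map_add' v w := by
    simp only [map_add, Pi.add_apply, inner_sub_right, inner_add_right]
    ring
  map_smul' c w := by
    simp only [map_smul, Pi.smul_apply, inner_sub_right, inner_smul_right, smul_eq_mul,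
      RingHom.id_apply]
    ring

theorem jacobian_apply_eq_sum (N : GNSSNetwork R S C) (ref : Fin C)
    (y : Agent R S → EuclideanSpace ℝ (Fin d)) (i : N.Measurement)
    (w : Unknown d R ref → ℝ) :
    N.jacobian ref y i w = ∑ k, N.jacobian ref y i (Pi.single k 1) * w k := by
  conv_lhs => rw [LinearMap.pi_apply_eq_sum_univ (N.jacobian ref y i) w]
  refine Finset.sum_congr rfl fun k _ => ?_
  rw [smul_eq_mul, mul_comm]
  congr 2
  ext l
  simp [Pi.single_apply, eq_comm]

/-- Scaling by the distance has removed the denominator of the gradient of the norm, and an inverse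
distance need not be integral. -/
theorem jacobian_mem_integralAnalyticGerm (N : GNSSNetwork R S C) (ref : Fin C)
    {x : Agent R S → EuclideanSpace ℝ (Fin d)} (hx : Function.Injective x) (i : N.Measurement)
    (k : Unknown d R ref) :
    ((fun y => N.jacobian ref y i (Pi.single k 1) :
      (Agent R S → EuclideanSpace ℝ (Fin d)) → ℝ) : Germ (𝓝 x) ℝ) ∈
      integralAnalyticGerm (coordGerm x) := by
  choose n hn using fun a j => posVelocity_single (S := S) ref k a j
  choose m hm using N.biasVelocity_single ref k
  have h1 : (fun y => N.jacobian ref y i (Pi.single k 1) :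
      (Agent R S → EuclideanSpace ℝ (Fin d)) → ℝ) =
      ∑ j, (fun y => y (N.ends i).1 j - y (N.ends i).2 j) *
        (((n (N.ends i).1 j - n (N.ends i).2 j : ℤ)) :
          (Agent R S → EuclideanSpace ℝ (Fin d)) → ℝ) +
      (fun y => ‖y (N.ends i).1 - y (N.ends i).2‖) *
        ((N.biasCoeff i * (m (N.ends i).2 - m (N.ends i).1) : ℤ) :
          (Agent R S → EuclideanSpace ℝ (Fin d)) → ℝ) := by
    ext y
    simp [jacobian, PiLp.inner_apply, hn, hm, mul_comm]
  have h2 := congrArg (Germ.coeRingHom (𝓝 x)) h1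
  simp only [map_add, map_sum, map_mul, map_intCast] at h2
  change Germ.coeRingHom (𝓝 x) _ ∈ _
  rw [h2]
  exact add_mem (sum_mem fun j _ => mul_mem (coord_sub_mem_integralAnalyticGerm _ _ j)
    (intCast_mem _ _)) (mul_mem (norm_sub_mem_integralAnalyticGerm
      (hx.ne (N.ends_ne i))) (intCast_mem _ _))

theorem hasDerivAt_measure (N : GNSSNetwork R S C) (ref : Fin C) (p : Config d R S)
    {α : ℝ → Unknown d R ref → ℝ} {α' : Unknown d R ref → ℝ} {t : ℝ} (hα : HasDerivAt α α' t)
    (i : N.Measurement)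
    (hne : (N.shift ref p (α t)).1 (N.ends i).1 ≠ (N.shift ref p (α t)).1 (N.ends i).2) :
    HasDerivAt (fun s => N.measure (N.shift ref p (α s)) i)
      (N.jacobian ref (N.shift ref p (α t)).1 i α' /
        ‖(N.shift ref p (α t)).1 (N.ends i).1 - (N.shift ref p (α t)).1 (N.ends i).2‖) t := by
  have hpos : ∀ a, HasDerivAt (fun s => (N.shift ref p (α s)).1 a) (posVelocity S ref α' a) t :=
    fun a => (hasDerivAt_pi.1 ((posVelocity S ref).hasFDerivAt.comp_hasDerivAt t hα) a).const_add _
  have hbias : ∀ a, HasDerivAt (fun s => (N.shift ref p (α s)).2 a)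
      (N.biasVelocity d ref α' a) t :=
    fun a => (hasDerivAt_pi.1
      ((N.biasVelocity d ref).hasFDerivAt.comp_hasDerivAt t hα) a).const_add _
  have h := (((hpos (N.ends i).1).sub (hpos (N.ends i).2)).norm_of_ne_zero
    (sub_ne_zero.2 hne)).add (((hbias (N.ends i).2).sub (hbias (N.ends i).1)).const_mul
      (N.biasCoeff i : ℝ))
  refine h.congr_deriv ?_
  have h0 : ‖(N.shift ref p (α t)).1 (N.ends i).1 - (N.shift ref p (α t)).1 (N.ends i).2‖ ≠ 0 :=
    norm_ne_zero_iff.2 (sub_ne_zero.2 hne)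
  simp only [jacobian, LinearMap.coe_mk, AddHom.coe_mk, Pi.sub_apply]
  rw [add_div, mul_div_cancel_left₀ _ h0]

theorem le_numMeasurements_of_solvable (N : GNSSNetwork R S C) (ref : Fin C) {p : Config d R S}
    (hd : 0 < d) (hp : p.Generic) (hsync : N.Synchronized p) (hsol : N.Solvable ref p) :
    R * (d + 1) + C - 1 ≤ N.numMeasurements := by
  by_contra! hlt
  have hinj := hp.injective hd
  obtain ⟨v, hv, ⟨k₀, hk₀⟩, hker⟩ := exists_analyticAt_mulVec_eq_zero (coordGerm p.1) coordGerm_mem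
    (fun a ha => hp a (by rw [← value_coordGerm]; exact ha))
    (by rw [card_measurement, card_unknown ref (d := d)]; exact hlt)
    (fun y i k => N.jacobian ref y i (Pi.single k 1))
    (fun i k => N.jacobian_mem_integralAnalyticGerm ref hinj i k)
  -- The Jacobian does not involve the biases, so the kernel field depends on the unknowns through
  -- the positions only.
  let V : (Unknown d R ref → ℝ) → Unknown d R ref → ℝ := fun u k => v k (N.shift ref p u).1
  have hshift : ContDiff ℝ ⊤ (N.shift ref p) := by
    unfold shift
    fun_prop
  have hV : ContDiffAt ℝ 1 V 0 := by
    refine contDiffAt_pi.2 fun k => ?_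
    refine ContDiffAt.comp (0 : Unknown d R ref → ℝ) (g := v k)
      (f := fun u => (N.shift ref p u).1) ?_ (hshift.fst.contDiffAt.of_le le_top)
    rw [shift_zero]
    exact (hv k).contDiffAt
  obtain ⟨α, hα0, ε, hε, hα⟩ :=
    hV.exists_forall_mem_closedBall_exists_eq_forall_mem_Ioo_hasDerivAt₀ 0
  have hα' : ∀ᶠ t in 𝓝 (0 : ℝ), HasDerivAt α (V (α t)) t :=
    eventually_of_mem (Ioo_mem_nhds (by linarith) (by linarith)) hα
  have hcont : Tendsto (fun t => N.shift ref p (α t)) (𝓝 0) (𝓝 p) := by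
    have h : ContinuousAt (fun t => N.shift ref p (α t)) 0 :=
      hshift.continuous.continuousAt.comp hα'.self_of_nhds.continuousAt
    simpa [ContinuousAt, hα0] using h
  have hne : ∀ᶠ y in 𝓝 p.1, ∀ i : N.Measurement, y (N.ends i).1 ≠ y (N.ends i).2 :=
    eventually_all.2 fun i => ((continuous_apply (N.ends i).1).continuousAt.ne_iff_eventually_ne
      (continuous_apply (N.ends i).2).continuousAt).1 (hinj.ne (N.ends_ne i))
  have hfst : Tendsto (fun t => (N.shift ref p (α t)).1) (𝓝 0) (𝓝 p.1) :=
    (continuous_fst.tendsto p).comp hcont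
  obtain ⟨δ, hδ, hball⟩ := Metric.eventually_nhds_iff_ball.1
    (hα'.and (hfst.eventually (hker.and hne)))
  -- The velocity of `α` lies in the kernel of the Jacobian, so every measurement has derivative
  -- zero along the curve.
  have hmeas : ∀ t ∈ Metric.ball (0 : ℝ) δ, ∀ i,
      N.measure (N.shift ref p (α t)) i = N.measure p i := by
    intro t ht i
    have hder : ∀ s ∈ Metric.ball (0 : ℝ) δ,
        HasDerivAt (fun s => N.measure (N.shift ref p (α s)) i) 0 s := by
      intro s hs
      obtain ⟨h1, h2, h3⟩ := hball s hs
      have h := N.hasDerivAt_measure ref p h1 i (h3 i)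
      rwa [jacobian_apply_eq_sum, h2 i, zero_div] at h
    have h := Metric.isOpen_ball.is_const_of_deriv_eq_zero (convex_ball (0 : ℝ) δ).isPreconnected
      (fun s hs => (hder s hs).differentiableAt.differentiableWithinAt)
      (fun s hs => (hder s hs).deriv) ht (Metric.mem_ball_self hδ)
    simpa [hα0] using h
  have hsolution : ∀ᶠ t in 𝓝 (0 : ℝ), N.shift ref p (α t) ∈ N.solutionSet ref p := by
    filter_upwards [Metric.ball_mem_nhds (0 : ℝ) hδ] with t ht
    refine N.mem_solutionSet_of_measure_eq ref (fun s => ?_) (fun s hs => ?_)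
      (hsync.shift ref _) (hmeas t ht)
    · simp [shift]
    · simp [shift, biasVelocity_inr, hs]
  have hiso : ∀ᶠ q in 𝓝 p, q ∈ N.solutionSet ref p → q = p := by
    have hmem : p ∈ N.solutionSet ref p :=
      N.mem_solutionSet_of_measure_eq ref (fun _ => rfl) (fun _ _ => rfl) hsync fun _ => rfl
    have h := isDiscrete_iff_nhdsNE.1 hsol p hmem
    rw [← disjoint_iff, disjoint_principal_right, mem_nhdsWithin_iff_eventually] at h
    filter_upwards [h] with q hq hqS
    by_contra hqp
    exact hq hqp hqS
  -- Isolation of `p` freezes the curve, so its initial velocity is zero, against `hk₀`.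
  have hconst : α =ᶠ[𝓝 0] fun _ => 0 := by
    filter_upwards [hsolution, hcont.eventually hiso] with t h1 h2
    exact N.shift_injective ref p ((h2 h1).trans (N.shift_zero ref p).symm)
  have hV0 : V (α 0) = 0 := hα'.self_of_nhds.unique
    ((hasDerivAt_const (0 : ℝ) (0 : Unknown d R ref → ℝ)).congr_of_eventuallyEq hconst)
  refine hk₀ ?_
  have h := congrFun hV0 k₀
  simpa [V, hα0] using h

end GNSSNetwork

/-! ### Finiteness of the solutions for one receiver. -/

section Multilateration

variable {F : Type*} [NormedAddCommGroup F] [InnerProductSpace ℝ F]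

/-- Squaring the four equations and taking the double difference cancels all quadratic terms. -/
theorem inner_sub_eq_of_norm_sub_eq {a a₀ z z' : F} {y y₀ b b' : ℝ} (h : ‖a - z‖ = y - b)
    (h₀ : ‖a₀ - z‖ = y₀ - b) (h' : ‖a - z'‖ = y - b') (h₀' : ‖a₀ - z'‖ = y₀ - b') :
    inner ℝ (z' - z) (a - a₀) = (b' - b) * (y - y₀) := by
  have e := congrArg (· ^ 2) h
  have e₀ := congrArg (· ^ 2) h₀
  have e' := congrArg (· ^ 2) h'
  have e₀' := congrArg (· ^ 2) h₀'
  simp only [norm_sub_sq_real] at e e₀ e' e₀'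
  simp only [inner_sub_right, real_inner_comm a, real_inner_comm a₀]
  linarith

/-- The squared equation is quadratic in `c` with the three distinct roots `0`, `c`, `c'`, so its
coefficients vanish: `‖B‖ = 1` and `inner ℝ a B = h`. Hence `‖a - h • B‖ ^ 2 = 0`. -/
theorem eq_smul_of_norm_sub_smul_eq {a B : F} {h c c' : ℝ} (hc : c ≠ 0) (hc' : c' ≠ 0)
    (hcc : c ≠ c') (ha : ‖a‖ = h) (h1 : ‖a - c • B‖ = h - c) (h2 : ‖a - c' • B‖ = h - c') :
    a = h • B := by
  have e1 := congrArg (· ^ 2) h1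
  have e2 := congrArg (· ^ 2) h2
  simp only [norm_sub_sq_real, inner_smul_right, norm_smul, mul_pow, Real.norm_eq_abs, sq_abs,
    ha] at e1 e2
  have f1 : c * (‖B‖ ^ 2 - 1) = 2 * (inner ℝ a B - h) :=
    mul_left_cancel₀ hc (by linarith)
  have f2 : c' * (‖B‖ ^ 2 - 1) = 2 * (inner ℝ a B - h) :=
    mul_left_cancel₀ hc' (by linarith)
  have hB : ‖B‖ ^ 2 - 1 = 0 :=
    (mul_eq_zero.1 (show (c - c') * (‖B‖ ^ 2 - 1) = 0 by linarith)).resolve_left (sub_ne_zero.2 hcc)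
  rw [hB, mul_zero] at f1
  rw [← sub_eq_zero, ← norm_eq_zero, ← sq_eq_zero_iff, norm_sub_sq_real, inner_smul_right,
    norm_smul, mul_pow, Real.norm_eq_abs, sq_abs, ha]
  have hB' : ‖B‖ ^ 2 = 1 := by linarith
  have hi : inner ℝ a B = h := by linarith
  rw [hB', hi]
  ring

/-- The pseudoranges from senders whose differences span a space of dimension at least two leave
only finitely many possibilities for the position and the bias of the receiver. -/
theorem finite_setOf_norm_sub_eq [FiniteDimensional ℝ F] (hF : 2 ≤ Module.finrank ℝ F)
    {ι : Type*} (a : ι → F) (i₀ : ι)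
    (hspan : ∀ w : F, (∀ i, inner ℝ w (a i - a i₀) = 0) → w = 0) (y : ι → ℝ) :
    {q : F × ℝ | ∀ i, ‖a i - q.1‖ = y i - q.2}.Finite := by
  classical
  by_contra hinf
  obtain ⟨t, ht, htcard⟩ := Set.Infinite.exists_subset_card_eq hinf 3
  obtain ⟨q₁, q₂, q₃, h12, h13, h23, rfl⟩ := Finset.card_eq_three.1 htcard
  have hq₁ : ∀ i, ‖a i - q₁.1‖ = y i - q₁.2 := ht (by simp)
  have hq₂ : ∀ i, ‖a i - q₂.1‖ = y i - q₂.2 := ht (by simp)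
  have hq₃ : ∀ i, ‖a i - q₃.1‖ = y i - q₃.2 := ht (by simp)
  have key : ∀ q q' : F × ℝ, (∀ i, ‖a i - q.1‖ = y i - q.2) →
      (∀ i, ‖a i - q'.1‖ = y i - q'.2) → ∀ i,
        inner ℝ (q'.1 - q.1) (a i - a i₀) = (q'.2 - q.2) * (y i - y i₀) :=
    fun q q' h h' i => inner_sub_eq_of_norm_sub_eq (h i) (h i₀) (h' i) (h' i₀)
  have hne : ∀ q q' : F × ℝ, (∀ i, ‖a i - q.1‖ = y i - q.2) →
      (∀ i, ‖a i - q'.1‖ = y i - q'.2) → q ≠ q' → q.2 ≠ q'.2 := by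
    intro q q' h h' hqq hb
    refine hqq (Prod.ext (sub_eq_zero.1 (hspan _ fun i => ?_)).symm hb)
    rw [key q q' h h' i, hb, sub_self, zero_mul]
  have hc₂ : q₂.2 - q₁.2 ≠ 0 := sub_ne_zero.2 (hne _ _ hq₁ hq₂ h12).symm
  have hc₃ : q₃.2 - q₁.2 ≠ 0 := sub_ne_zero.2 (hne _ _ hq₁ hq₃ h13).symm
  have hc₂₃ : q₂.2 - q₁.2 ≠ q₃.2 - q₁.2 := fun h => hne _ _ hq₂ hq₃ h23 (by linarith)
  -- By `key`, displacements are determined linearly by bias differences, so three solutions lie on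
  -- a line in direction `B`. By `hline` all senders then lie on a line too, which dimension at
  -- least two excludes: take `w` orthogonal to `B`.
  obtain ⟨B, hB₂, hB₃⟩ : ∃ B : F, q₂.1 - q₁.1 = (q₂.2 - q₁.2) • B ∧
      q₃.1 - q₁.1 = (q₃.2 - q₁.2) • B := by
    refine ⟨(q₂.2 - q₁.2)⁻¹ • (q₂.1 - q₁.1), (smul_inv_smul₀ hc₂ _).symm, ?_⟩
    refine sub_eq_zero.1 (hspan _ fun i => ?_)
    rw [inner_sub_left, inner_smul_left, inner_smul_left, key _ _ hq₁ hq₂, key _ _ hq₁ hq₃]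
    simp only [conj_trivial]
    field_simp
    ring
  have hline : ∀ i, a i - q₁.1 = (y i - q₁.2) • B := by
    intro i
    refine eq_smul_of_norm_sub_smul_eq hc₂ hc₃ hc₂₃ (hq₁ i) ?_ ?_
    · rw [← hB₂, sub_sub_sub_cancel_right, hq₂ i, sub_sub_sub_cancel_right]
    · rw [← hB₃, sub_sub_sub_cancel_right, hq₃ i, sub_sub_sub_cancel_right]
  have hker : LinearMap.ker (innerₛₗ ℝ B) ≠ ⊥ :=
    LinearMap.ker_ne_bot_of_finrank_lt (by rw [Module.finrank_self]; omega)
  obtain ⟨w, hw, hw0⟩ := Submodule.exists_mem_ne_zero_of_ne_bot hker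
  refine hw0 (hspan w fun i => ?_)
  have hwB : inner ℝ w B = 0 := by
    rw [real_inner_comm]
    exact hw
  rw [← sub_sub_sub_cancel_right (a i) (a i₀) q₁.1, hline i, hline i₀, ← sub_smul,
    inner_smul_right, hwB, mul_zero]

end Multilateration

/-- The differences of `d + 1` agents in generic position span the space. -/
theorem Config.Generic.eq_zero_of_inner_sub_eq_zero {d R S : ℕ} {p : Config d R S}
    (hp : p.Generic) {σ : Fin (d + 1) → Agent R S} (hσ : Function.Injective σ)
    (w : EuclideanSpace ℝ (Fin d)) (hw : ∀ i, inner ℝ w (p.1 (σ i) - p.1 (σ 0)) = 0) : w = 0 := by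
  classical
  let M : Matrix (Fin d) (Fin d) (MvPolynomial (Agent R S × Fin d) ℤ) :=
    Matrix.of fun i j => MvPolynomial.X (σ i.succ, j) - MvPolynomial.X (σ 0, j)
  have hM : M.det ≠ 0 := by
    intro h
    -- Placing agent `σ 0` at the origin and `σ j.succ` at the `j`-th basis vector turns `M` into
    -- the identity, so its determinant is a nonzero polynomial.
    have h' := congrArg (MvPolynomial.aeval (R := ℤ)
      (fun u : Agent R S × Fin d => if u.1 = σ u.2.succ then (1 : ℤ) else 0)) h
    rw [AlgHom.map_det, map_zero] at h'
    have h1 : (MvPolynomial.aeval (R := ℤ) (fun u : Agent R S × Fin d =>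
        if u.1 = σ u.2.succ then (1 : ℤ) else 0)).mapMatrix M = 1 := by
      ext i j
      simp [M, AlgHom.mapMatrix_apply, Matrix.one_apply, hσ.eq_iff, (Fin.succ_ne_zero _).symm]
    rw [h1, Matrix.det_one] at h'
    exact one_ne_zero h'
  have hdet : ((MvPolynomial.aeval fun i : Agent R S × Fin d => p.1 i.1 i.2).mapMatrix M).det
      ≠ 0 := by
    rw [← AlgHom.map_det]
    exact fun h => hM (hp _ h)
  have h := Matrix.eq_zero_of_mulVec_eq_zero hdet (v := WithLp.ofLp w) (by
    ext i
    simpa [M, AlgHom.mapMatrix_apply, Matrix.mulVec, dotProduct, PiLp.inner_apply] using hw i.succ)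
  ext j
  exact congrFun h j

/-! ### A network attaining the bound. -/

namespace GNSSNetwork

/-- Receiver `r₀` uses all of `d + C` satellites, the other receivers use the first `d + 1`, which
form one constellation. -/
def starNetwork (d C : ℕ) {R : ℕ} (hC : 1 ≤ C) (r₀ : Fin R) : GNSSNetwork R (d + C) C where
  -- Truncated subtraction: satellites `0, …, d` form constellation `0`, and satellite `d + c`
  -- belongs to constellation `c`.
  constellation s := ⟨s.1 - d, by omega⟩
  constellation_surjective c := ⟨⟨d + c.1, by omega⟩, by simp⟩
  pseudoranges := Finset.univ ×ˢ {r₀} ∪ Finset.Iic ⟨d, by omega⟩ ×ˢ {r₀}ᶜ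
  distances := ⊥

variable {d R C : ℕ}

/-- The count is `(d + C) + (R - 1) * (d + 1)`. -/
theorem numMeasurements_starNetwork (hC : 1 ≤ C) (r₀ : Fin R) :
    (starNetwork d C hC r₀).numMeasurements = R * (d + 1) + C - 1 := by
  have hdisj : Disjoint ((Finset.univ : Finset (Fin (d + C))) ×ˢ {r₀})
      (Finset.Iic (⟨d, by omega⟩ : Fin (d + C)) ×ˢ {r₀}ᶜ) :=
    Finset.disjoint_product.2 (Or.inr disjoint_compl_right)
  obtain ⟨n, rfl⟩ : ∃ n, R = n + 1 := Nat.exists_eq_succ_of_ne_zero (Fin.pos r₀).ne'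
  simp only [numMeasurements, starNetwork, Finset.card_union_of_disjoint hdisj,
    Finset.card_product, Finset.card_univ, Fintype.card_fin, Finset.card_singleton, Fin.card_Iic,
    Finset.card_compl, SimpleGraph.edgeSet_bot, Set.ncard_empty, Nat.add_sub_cancel]
  rw [mul_comm (d + 1) n, add_mul n 1]
  omega

theorem solvable_starNetwork (hd : 2 ≤ d) (hC : 1 ≤ C) (r₀ : Fin R) (ref : Fin C)
    {p : Config d R (d + C)} (hp : p.Generic) : (starNetwork d C hC r₀).Solvable ref p := by
  let sat : Fin (d + 1) → Fin (d + C) := fun i => ⟨i.1, by omega⟩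
  have hsat : Function.Injective fun i => (Sum.inr (sat i) : Agent R (d + C)) := fun i j h =>
    by
    simpa [sat, Fin.ext_iff] using h
  have hconst : ∀ i, (starNetwork d C hC r₀).constellation (sat i) =
      (starNetwork d C hC r₀).constellation (sat 0) := fun i => by
    ext
    simp only [starNetwork, sat, Fin.val_zero]
    omega
  have hrange : ∀ i r, (sat i, r) ∈ (starNetwork d C hC r₀).pseudoranges := fun i r => by
    by_cases hr : r = r₀
    · simp [starNetwork, hr]
    · simp [starNetwork, hr, sat, Fin.le_def, Nat.lt_succ_iff.1 i.2]
  have hrange₀ : ∀ s, (s, r₀) ∈ (starNetwork d C hC r₀).pseudoranges := fun s => by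
    simp [starNetwork]
  let Z : Fin R → Set (EuclideanSpace ℝ (Fin d) × ℝ) := fun r =>
    {z | ∀ i, ‖p.1 (Sum.inr (sat i)) - z.1‖ =
      p.pseudorange (Sum.inr (sat i)) (Sum.inl r) - z.2}
  have hZ : (Set.univ.pi Z).Finite := Set.Finite.pi fun r =>
    finite_setOf_norm_sub_eq (by simpa using hd) (fun i => p.1 (Sum.inr (sat i))) 0
      (hp.eq_zero_of_inner_sub_eq_zero hsat)
      fun i => p.pseudorange (Sum.inr (sat i)) (Sum.inl r)
  -- Receiver biases are taken relative to the constellation of `sat 0`, which need not be the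
  -- reference `ref`.
  refine (Set.Finite.of_injOn (t := Set.univ.pi Z) (f := fun q : Config d R (d + C) => fun r =>
    (q.1 (Sum.inl r), q.2 (Sum.inl r) - q.2 (Sum.inr (sat 0)))) ?_ ?_ hZ).isDiscrete
  · rintro q ⟨hpos, -, hsync, hq, -⟩ r - i
    have h := hq _ _ (hrange i r)
    rw [← h, Config.pseudorange, hpos, hsync _ _ (hconst i)]
    ring
  · rintro q ⟨hpos, hbias, -, hq, -⟩ q' ⟨hpos', hbias', -, hq', -⟩ heq
    have h1 : ∀ r, q.1 (Sum.inl r) = q'.1 (Sum.inl r) := fun r =>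
      congrArg Prod.fst (congrFun heq r)
    have h2 : ∀ r, q.2 (Sum.inl r) - q.2 (Sum.inr (sat 0)) =
        q'.2 (Sum.inl r) - q'.2 (Sum.inr (sat 0)) := fun r =>
      congrArg Prod.snd (congrFun heq r)
    -- Receiver `r₀` sees every satellite, so its position fixes all satellite biases relative to
    -- its own; a reference satellite then fixes the absolute values.
    have h3 : ∀ s, q.2 (Sum.inl r₀) - q.2 (Sum.inr s) =
        q'.2 (Sum.inl r₀) - q'.2 (Sum.inr s) := fun s => by
      have h := (hq _ _ (hrange₀ s)).trans (hq' _ _ (hrange₀ s)).symm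
      rw [Config.pseudorange, Config.pseudorange, hpos, hpos', h1] at h
      linarith
    obtain ⟨s, hs⟩ := (starNetwork d C hC r₀).constellation_surjective ref
    have h4 : q.2 (Sum.inl r₀) = q'.2 (Sum.inl r₀) := by
      have h := h3 s
      rw [hbias s hs, hbias' s hs] at h
      linarith
    refine Prod.ext (funext fun u => ?_) (funext fun u => ?_)
    · rcases u with r | s
      · exact h1 r
      · rw [hpos, hpos']
    · have h5 : ∀ s, q.2 (Sum.inr s) = q'.2 (Sum.inr s) := fun s => by
        linarith [h3 s]
      rcases u with r | s
      · linarith [h2 r, h5 (sat 0)]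
      · exact h5 s

end GNSSNetwork

/-- Locating a network of `R` receivers with satellites from `C` constellations in dimension `d`
needs at least `R (d + 1) + C - 1` measurements, at whatever generic configuration, and this number
is attained by a network that can be located at all generic configurations. For `R = 1` it is
`d + C`. -/
theorem lemma5 (d R C : ℕ) (hd : 2 ≤ d) (hR : 1 ≤ R) (hC : 1 ≤ C) :
    (∀ (S : ℕ) (N : GNSSNetwork R S C) (ref : Fin C) (p : Config d R S),
      p.Generic → N.Synchronized p → N.Solvable ref p →
        R * (d + 1) + C - 1 ≤ N.numMeasurements) ∧
    (∃ (S : ℕ) (N : GNSSNetwork R S C), d ≤ S ∧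
      N.numMeasurements = R * (d + 1) + C - 1 ∧
      (∃ p : Config d R S, p.Generic ∧ N.Synchronized p) ∧
      ∀ (ref : Fin C) (p : Config d R S),
        p.Generic → N.Synchronized p → N.Solvable ref p) ∧
    (R = 1 → R * (d + 1) + C - 1 = d + C) := by
  refine ⟨fun S N ref p hp hsync hsol =>
      N.le_numMeasurements_of_solvable ref (by omega) hp hsync hsol,
    ⟨d + C, GNSSNetwork.starNetwork d C hC (⟨0, hR⟩ : Fin R), by omega,
      GNSSNetwork.numMeasurements_starNetwork hC _, ?_,
      fun ref p hp _ => GNSSNetwork.solvable_starNetwork hd hC _ ref hp⟩, ?_⟩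
  · obtain ⟨p, hp, hbias⟩ := Config.exists_generic d R (d + C)
    exact ⟨p, hp, fun s t _ => by rw [hbias, hbias]⟩
  · rintro rfl
    omega
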